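/- Let $n\ge 1$ and $|\rho|\le 1$, and put $\Sigma_\rho=\begin{bmatrix}1&\rho\\ \rho&1\end{bmatrix}$. Given a pair $(X,Y)\in\mathbb{R}^n\times\mathbb{R}^n$ of random sequences, consider the hypothesis testing problem $$\mathcal H_0:\ (X_1,Y_1),\dots,(X_n,Y_n)\ \overset{\text{i.i.d.}}{\sim}\ \mathcal N(0,\Sigma_0),\qquad \mathcal H_1:\ (X_1,Y_{\sigma(1)}),\dots,(X_n,Y_{\sigma(n)})\ \overset{\text{i.i.d.}}{\sim}\ \mathcal N(0,\Sigma_\rho)\ \text{ given }\sigma,$$ where $\sigma$ is a uniformly random permutation of $\{1,\dots,n\}$. Let $\mathbb P_{\mathcal H_0}$ and $\mathbb P_{\mathcal H_1}$ be the laws of $(X,Y)$ under the two hypotheses (so $\mathbb P_{\mathcal H_1}$ is averaged over $\sigma$), and let $$\mathsf R^\star=\mathsf R^\star(\rho,n)=\inf_{\phi}\big(\mathbb P_{\mathcal H_0}[\phi(X,Y)=1]+\mathbb P_{\mathcal H_1}[\phi(X,Y)=0]\big)$$ be the optimal risk, the infimum being over all measurable tests $\phi:\mathbb R^n\times\mathbb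 R^n\to\{0,1\}$. A sequence $(\rho_k,n_k)_k$ is called admissible for weak detection if $\limsup_{k\to\infty}\mathsf R^\star(\rho_k,n_k)<1$. **Theorem (impossibility of weak detection).** For every sequence $(\rho_k,n_k)_{k}$ with $|\rho_k|\le 1$ and $\rho_k^2\to 0$ as $k\to\infty$ (no condition being imposed on the positive integers $n_k$), $$\lim_{k\to\infty}\mathsf R^\star(\rho_k,n_k)=1 .$$ In particular, $(\rho_k,n_k)_k$ is not admissible for weak detection. -/

import Mathlib

open Filter Topology MeasureTheory ProbabilityTheory

namespace DatabaseDetection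

noncomputable section

/-- The covariance matrix `Σ_ρ` with unit diagonal and off-diagonal entries `ρ`. -/
def corrMatrix (ρ : ℝ) : Matrix (Fin 2) (Fin 2) ℝ := !![1, ρ; ρ, 1]

/-- The sample space of `(X, Y)`: pairs of real sequences of length `n`. -/
abbrev Obs (n : ℕ) : Type := (Fin n → ℝ) × (Fin n → ℝ)

/-- Turns pairs `w 0, w 1, …` into the observation `(X, Y)` with `(X i, Y (σ i)) = w i`
for all `i`. -/
def toObs {n : ℕ} (σ : Equiv.Perm (Fin n)) (w : Fin n → EuclideanSpace ℝ (Fin 2)) : Obs n :=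
  (fun i => w i 0, fun j => w (σ.symm j) 1)

/-- The law of `(X, Y)` when the pairs `(X i, Y (σ i))` are i.i.d. centred Gaussian vectors with
covariance matrix `Σ_ρ`. -/
def plantedLaw (ρ : ℝ) (n : ℕ) (σ : Equiv.Perm (Fin n)) : Measure (Obs n) :=
  (Measure.pi fun _ : Fin n => multivariateGaussian 0 (corrMatrix ρ)).map (toObs σ)

/-- The law of `(X, Y)` under the null hypothesis: the pairs `(X i, Y i)` are i.i.d. centred
Gaussian vectors with covariance matrix `Σ_0`. -/
def nullLaw (n : ℕ) : Measure (Obs n) :=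
  (Measure.pi fun _ : Fin n => multivariateGaussian 0 (corrMatrix 0)).map (toObs 1)

/-- The law of `(X, Y)` under the alternative hypothesis: the average of the planted laws over a
uniformly random permutation. -/
def altLaw (ρ : ℝ) (n : ℕ) : Measure (Obs n) :=
  (Fintype.card (Equiv.Perm (Fin n)) : ENNReal)⁻¹ • ∑ σ : Equiv.Perm (Fin n), plantedLaw ρ n σ

/-- The risk of a test: the sum of its Type-I and Type-II error probabilities. -/
def risk (ρ : ℝ) (n : ℕ) (φ : Obs n → Fin 2) : ℝ :=
  (nullLaw n).real {z | φ z = 1} + (altLaw ρ n).real {z | φ z = 0}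

/-- The optimal risk `R*`: the infimum of the risk over all (measurable) tests. -/
def optRisk (ρ : ℝ) (n : ℕ) : ℝ :=
  ⨅ φ : {φ : Obs n → Fin 2 // Measurable φ}, risk ρ n φ

/-- The sequence `(ρ_k, n_k)` is admissible for weak detection. -/
def AdmissibleWeak (ρ : ℕ → ℝ) (n : ℕ → ℕ) : Prop :=
  limsup (fun k => optRisk (ρ k) (n k)) atTop < 1

end

end DatabaseDetection

namespace DatabaseDetection

noncomputable section

/-! Second moment method. For `|ρ| < 1` the alternative has a likelihood ratio `L` against the null,
and every test has risk at least `1 - √(E₀[L²] - 1)` once `E₀[L²]` is finite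
(`sq_measureReal_sub_withDensity_le`). So it suffices that `E₀[L²] → 1` uniformly in `n` as `q = ρ²
→ 0`. Expanding `L²` over pairs `σ, τ` gives Gaussian integrals equal to `|det (1 - q P)|⁻¹`, with
`P` the matrix of `σ⁻¹ * τ` (`lintegral_plantedDensity_mul`). Hence `E₀[L²]` is the average `aₙ =
permAvg q n` of these reciprocals over all permutations. Deleting one point from its cycle gives a
recursion for `aₙ` (`succ_mul_permAvg_succ`) without any use of cycle types. Its differences satisfy
`aₙ₊₁ - aₙ ≤ tⁿ⁺¹` with `t = q / (1 - q)`, so for `q < 1/2` every `aₙ` is at most `1 / (1 - t)`,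
which is free of `n` and tends to 1. -/

/-! ### Averages of reciprocal determinants over permutations. -/

/-- The matrix `1 - D P`, where `D` is the diagonal matrix with entries `w` and `P` is the matrix
of the permutation `π`. -/
def oneSubPermMatrix {ι : Type*} [DecidableEq ι] (w : ι → ℝ) (π : Equiv.Perm ι) :
    Matrix ι ι ℝ :=
  Matrix.of fun i j => (if i = j then 1 else 0) - w i * (if π i = j then 1 else 0)

/-- The sum over all permutations of the reciprocals of `|det (1 - D P)|`. -/
def permSum {n : ℕ} (w : Fin n → ℝ) : ℝ :=
  ∑ π : Equiv.Perm (Fin n), |(oneSubPermMatrix w π).det|⁻¹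

lemma permSum_zero (w : Fin 0 → ℝ) : permSum w = 1 := by
  simp [permSum]

lemma permSum_comp {n : ℕ} (w : Fin n → ℝ) (τ : Equiv.Perm (Fin n)) :
    permSum (w ∘ τ) = permSum w := by
  unfold permSum
  refine Fintype.sum_equiv (MulAut.conj τ).toEquiv _ _ fun π => ?_
  rw [← Matrix.det_submatrix_equiv_self τ (oneSubPermMatrix w _)]
  congr 3
  ext i j
  simp [oneSubPermMatrix]

lemma permSum_update_const {n : ℕ} (q x : ℝ) (i : Fin (n + 1)) :
    permSum (Function.update (fun _ => q) i x) =
      permSum (Fin.cons x fun _ : Fin n => q : Fin (n + 1) → ℝ) := by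
  rw [← permSum_comp _ (Equiv.swap 0 i)]
  congr 1
  ext j
  refine Fin.cases ?_ (fun j => ?_) j
  · simp
  · by_cases h : j.succ = i
    · subst h
      simpa [Function.update_apply] using fun h => absurd h.symm (Fin.succ_ne_zero j)
    · rw [Function.comp_apply, Equiv.swap_apply_of_ne_of_ne (Fin.succ_ne_zero _) h]
      simp [h]

lemma det_oneSubPermMatrix_decomposeFin_zero {n : ℕ} (w : Fin (n + 1) → ℝ)
    (e : Equiv.Perm (Fin n)) :
    (oneSubPermMatrix w (Equiv.Perm.decomposeFin.symm (0, e))).det =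
      (1 - w 0) * (oneSubPermMatrix (Fin.tail w) e).det := by
  rw [Matrix.det_succ_column_zero, Fin.sum_univ_succ, Finset.sum_eq_zero, add_zero]
  · have : (oneSubPermMatrix w (Equiv.Perm.decomposeFin.symm (0, e))).submatrix
        (Fin.succAbove 0) Fin.succ = oneSubPermMatrix (Fin.tail w) e := by
      ext i j
      simp [oneSubPermMatrix, Fin.tail]
    rw [this]
    simp [oneSubPermMatrix]
  · intro i _
    simp [oneSubPermMatrix, Fin.succ_ne_zero]

/-- The permutation sends `i.succ` to `0` and `0` to `(e i).succ`. Cutting `0` out of the cycle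
leaves `e`, and its predecessor `i` inherits the product of the two weights. -/
lemma det_oneSubPermMatrix_decomposeFin_succ {n : ℕ} (w : Fin (n + 1) → ℝ)
    (e : Equiv.Perm (Fin n)) (i : Fin n) :
    (oneSubPermMatrix w (Equiv.Perm.decomposeFin.symm ((e i).succ, e))).det =
      (oneSubPermMatrix (Function.update (Fin.tail w) i (w 0 * w i.succ)) e).det := by
  set A := oneSubPermMatrix w (Equiv.Perm.decomposeFin.symm ((e i).succ, e)) with hA
  -- Adding `w i.succ` times row `0` to row `i.succ` clears column `0` below the diagonal.
  let c : Fin (n + 1) → ℝ := fun k => if k = i.succ then w i.succ else 0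
  let B : Matrix (Fin (n + 1)) (Fin (n + 1)) ℝ := Matrix.of fun k j => A k j + c k * A 0 j
  have hc : c 0 = 0 := by simp [c, (Fin.succ_ne_zero i).symm]
  have hAB : A.det = B.det := by
    symm
    refine Matrix.det_eq_of_forall_row_eq_smul_add_const c 0 hc fun k j => ?_
    simp [B]
  have hswap : ∀ k : Fin n, k ≠ i →
      Equiv.swap 0 (e i).succ (e k).succ = (e k).succ := fun k hk =>
    Equiv.swap_apply_of_ne_of_ne (Fin.succ_ne_zero _) (by simpa using hk)
  rw [hAB, Matrix.det_succ_column_zero, Fin.sum_univ_succ, Finset.sum_eq_zero, add_zero]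
  · have : B.submatrix (Fin.succAbove 0) Fin.succ =
        oneSubPermMatrix (Function.update (Fin.tail w) i (w 0 * w i.succ)) e := by
      ext k j
      by_cases hk : k = i
      · subst hk
        simp [B, c, hA, oneSubPermMatrix, (Fin.succ_ne_zero _).symm]
        split_ifs <;> ring
      · simp [B, c, hA, oneSubPermMatrix, hswap k hk, hk, Fin.tail]
    rw [this]
    simp [B, hc, hA, oneSubPermMatrix, Fin.succ_ne_zero]
  · intro k _
    by_cases hk : k = i
    · subst hk
      simp [B, c, hA, oneSubPermMatrix, Fin.succ_ne_zero]
    · simp [B, c, hA, oneSubPermMatrix, Fin.succ_ne_zero, hswap k hk, hk]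

lemma permSum_succ {n : ℕ} (w : Fin (n + 1) → ℝ) :
    permSum w = |1 - w 0|⁻¹ * permSum (Fin.tail w) +
      ∑ i, permSum (Function.update (Fin.tail w) i (w 0 * w i.succ)) := by
  unfold permSum
  rw [← Equiv.sum_comp Equiv.Perm.decomposeFin.symm, Fintype.sum_prod_type, Fin.sum_univ_succ]
  congr 1
  · simp_rw [det_oneSubPermMatrix_decomposeFin_zero, abs_mul, mul_inv, Finset.mul_sum]
  · rw [Finset.sum_comm]
    conv_rhs => rw [Finset.sum_comm]
    refine Finset.sum_congr rfl fun e _ => ?_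
    rw [← Equiv.sum_comp e]
    simp_rw [det_oneSubPermMatrix_decomposeFin_succ]

lemma permSum_cons_const {n : ℕ} (q x : ℝ) :
    permSum (Fin.cons x fun _ : Fin (n + 1) => q : Fin (n + 2) → ℝ) =
      |1 - x|⁻¹ * permSum (fun _ : Fin (n + 1) => q) +
        (n + 1) * permSum (Fin.cons (x * q) fun _ : Fin n => q : Fin (n + 1) → ℝ) := by
  rw [permSum_succ]
  simp [permSum_update_const]

/-- The average over all permutations of the reciprocals of `|det (1 - q P)|`. -/
def permAvg (q : ℝ) (n : ℕ) : ℝ := permSum (fun _ : Fin n => q) / n.factorial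

/-- The weight `q ^ m` stands for `m` points of one cycle already merged. The index `l` counts the
further points absorbed before the cycle closes with factor `|1 - q ^ (m + l)|⁻¹`; the case `m = 1`
is the recursion for `permAvg`. -/
lemma permSum_cons_pow_eq_sum (q : ℝ) (n m : ℕ) :
    permSum (Fin.cons (q ^ m) fun _ : Fin n => q : Fin (n + 1) → ℝ) / n.factorial =
      ∑ l ∈ Finset.range (n + 1), |1 - q ^ (m + l)|⁻¹ * permAvg q (n - l) := by
  induction n generalizing m with
  | zero =>
    rw [permSum_succ]
    simp [permAvg, permSum_zero]
  | succ n ih =>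
    rw [permSum_cons_const, Finset.sum_range_succ', ← pow_succ, add_div, add_comm]
    congr 1
    · rw [Nat.factorial_succ]
      push_cast
      rw [mul_div_mul_left _ _ (by positivity), ih]
      refine Finset.sum_congr rfl fun l _ => ?_
      rw [add_assoc m 1 l, add_comm 1 l]
    · simp [permAvg, mul_div_assoc]

lemma permAvg_zero (q : ℝ) : permAvg q 0 = 1 := by
  simp [permAvg, permSum_zero]

lemma succ_mul_permAvg_succ (q : ℝ) (n : ℕ) :
    (n + 1) * permAvg q (n + 1) =
      ∑ l ∈ Finset.range (n + 1), |1 - q ^ (l + 1)|⁻¹ * permAvg q (n - l) := by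
  have h := permSum_cons_pow_eq_sum q n 1
  simp_rw [add_comm 1] at h
  rw [← h, permAvg, Nat.factorial_succ]
  have : (Fin.cons (q ^ 1) fun _ : Fin n => q : Fin (n + 1) → ℝ) = fun _ => q := by
    ext j
    refine Fin.cases ?_ (fun j => ?_) j <;> simp
  rw [this]
  push_cast
  field_simp

/-- Subtract consecutive recursions and split each coefficient as `1 + q ^ (l + 1) / (1 - q ^ (l +
1))`: the constant parts telescope, leaving only small coefficients. -/
lemma succ_mul_permAvg_sub {q : ℝ} (hq0 : 0 ≤ q) (hq1 : q < 1) (n : ℕ) :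
    (n + 2) * (permAvg q (n + 2) - permAvg q (n + 1)) =
      ∑ l ∈ Finset.range (n + 1), q ^ (l + 1) / (1 - q ^ (l + 1)) *
        (permAvg q (n + 1 - l) - permAvg q (n - l)) + q ^ (n + 2) / (1 - q ^ (n + 2)) := by
  have hw (l : ℕ) : |1 - q ^ (l + 1)|⁻¹ = 1 + q ^ (l + 1) / (1 - q ^ (l + 1)) := by
    have : 0 < 1 - q ^ (l + 1) := sub_pos.2 (pow_lt_one₀ hq0 hq1 (by simp))
    rw [abs_of_pos this]
    field_simp
    ring
  have htel : ∑ l ∈ Finset.range (n + 1), (permAvg q (n + 1 - l) - permAvg q (n - l)) =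
      permAvg q (n + 1) - 1 := by
    have := Finset.sum_range_sub' (fun l => permAvg q (n + 1 - l)) (n + 1)
    simpa [permAvg_zero] using this
  have h1 := succ_mul_permAvg_succ q n
  have h2 := succ_mul_permAvg_succ q (n + 1)
  rw [Finset.sum_range_succ] at h2
  simp only [Nat.sub_self, permAvg_zero, hw] at h1 h2
  have h3 : ∑ l ∈ Finset.range (n + 1), (1 + q ^ (l + 1) / (1 - q ^ (l + 1))) *
        (permAvg q (n + 1 - l) - permAvg q (n - l)) =
      ∑ l ∈ Finset.range (n + 1), q ^ (l + 1) / (1 - q ^ (l + 1)) *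
        (permAvg q (n + 1 - l) - permAvg q (n - l)) + (permAvg q (n + 1) - 1) := by
    rw [← htel, ← Finset.sum_add_distrib]
    exact Finset.sum_congr rfl fun l _ => by ring
  simp_rw [mul_sub, Finset.sum_sub_distrib] at h3
  simp_rw [mul_sub, Finset.sum_sub_distrib]
  push_cast at h2
  linarith

lemma permAvg_succ_sub_le {q : ℝ} (hq0 : 0 ≤ q) (hq1 : q < 1) (n : ℕ) :
    permAvg q (n + 1) - permAvg q n ≤ (q / (1 - q)) ^ (n + 1) := by
  set t := q / (1 - q) with ht
  have h1q : 0 < 1 - q := by linarith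
  have ht0 : 0 ≤ t := by positivity
  have hqt : q ≤ t := by rw [ht, le_div_iff₀ h1q]; nlinarith
  have hr (l : ℕ) : 0 ≤ q ^ (l + 1) / (1 - q ^ (l + 1)) ∧
      q ^ (l + 1) / (1 - q ^ (l + 1)) ≤ t ^ (l + 1) := by
    have h2 : q ^ (l + 1) ≤ q := pow_le_of_le_one hq0 hq1.le (by simp)
    refine ⟨div_nonneg (by positivity) (by linarith), ?_⟩
    calc q ^ (l + 1) / (1 - q ^ (l + 1)) ≤ q ^ (l + 1) / (1 - q) := by gcongr
      _ = q ^ l * t := by rw [ht]; ring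
      _ ≤ t ^ l * t := by gcongr
      _ = t ^ (l + 1) := by ring
  induction n using Nat.strong_induction_on with
  | _ n ih =>
    rcases n with _ | n
    · have h := succ_mul_permAvg_succ q 0
      simp [permAvg_zero] at h
      rw [zero_add, permAvg_zero, h, abs_of_pos h1q, ht]
      apply le_of_eq
      field_simp
      ring
    · have h := succ_mul_permAvg_sub hq0 hq1 n
      -- These `n + 1` terms and the last one are each at most `t ^ (n + 2)`, which exactly matches
      -- the factor `n + 2` on the left.
      have hsum : ∑ l ∈ Finset.range (n + 1), q ^ (l + 1) / (1 - q ^ (l + 1)) *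
          (permAvg q (n + 1 - l) - permAvg q (n - l)) ≤
          ∑ l ∈ Finset.range (n + 1), t ^ (n + 2) := by
        refine Finset.sum_le_sum fun l hl => ?_
        have hl' : l ≤ n := by simpa [Nat.lt_succ_iff] using hl
        have := ih (n - l) (by omega)
        rw [show n - l + 1 = n + 1 - l by omega] at this
        calc _ ≤ q ^ (l + 1) / (1 - q ^ (l + 1)) * t ^ (n + 1 - l) :=
              mul_le_mul_of_nonneg_left this (hr l).1
          _ ≤ t ^ (l + 1) * t ^ (n + 1 - l) := by gcongr; exact (hr l).2
          _ = t ^ (n + 2) := by rw [← pow_add]; congr 1; omega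
      have hlast := (hr (n + 1)).2
      simp at hsum
      have hn : (0 : ℝ) < n + 2 := by positivity
      refine le_of_mul_le_mul_left ?_ hn
      rw [show n + 1 + 1 = n + 2 from rfl, h]
      nlinarith

lemma permAvg_le {q : ℝ} (hq0 : 0 ≤ q) (hq : q < 1 / 2) (n : ℕ) :
    permAvg q n ≤ (1 - q / (1 - q))⁻¹ := by
  have h1q : 0 < 1 - q := by linarith
  have ht0 : 0 ≤ q / (1 - q) := by positivity
  have ht1 : q / (1 - q) < 1 := by rw [div_lt_one h1q]; linarith
  have h : permAvg q n ≤ ∑ l ∈ Finset.range (n + 1), (q / (1 - q)) ^ l := by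
    induction n with
    | zero => simp [permAvg_zero]
    | succ n ih =>
      rw [Finset.sum_range_succ]
      linarith [permAvg_succ_sub_le hq0 (by linarith : q < 1) n]
  refine h.trans ?_
  rw [← tsum_geometric_of_lt_one ht0 ht1]
  exact (summable_geometric_of_lt_one ht0 ht1).sum_le_tsum _ fun _ _ => by positivity

/-! ### Integrals and densities on finite powers. -/

lemma lintegral_pi_prod {α : Type*} [MeasurableSpace α] (μ : Measure α) [SigmaFinite μ] {n : ℕ}
    (f : Fin n → α → ENNReal) (hf : ∀ i, Measurable (f i)) :
    ∫⁻ x, ∏ i, f i (x i) ∂Measure.pi (fun _ : Fin n => μ) = ∏ i, ∫⁻ x, f i x ∂μ := by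
  induction n with
  | zero => simp
  | succ n ih =>
    have e := (measurePreserving_piFinSuccAbove (fun _ : Fin (n + 1) => μ) 0).symm
    rw [← e.lintegral_comp (by fun_prop), lintegral_prod _ (by fun_prop), Fin.prod_univ_succ,
      ← ih _ fun i => hf i.succ, ← lintegral_mul_const _ (hf 0)]
    refine lintegral_congr fun x => ?_
    rw [← lintegral_const_mul _ (by fun_prop)]
    refine lintegral_congr fun y => ?_
    simp [Fin.prod_univ_succ, MeasurableEquiv.piFinSuccAbove]

lemma pi_withDensity {α : Type*} [MeasurableSpace α] (μ : Measure α) [SigmaFinite μ] (n : ℕ)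
    {f : α → ENNReal} (hf : Measurable f) [SigmaFinite (μ.withDensity f)] :
    Measure.pi (fun _ : Fin n => μ.withDensity f) =
      (Measure.pi fun _ : Fin n => μ).withDensity fun x => ∏ i, f (x i) := by
  refine (Measure.pi_eq fun s hs => ?_)
  rw [withDensity_apply _ (.univ_pi hs), ← lintegral_indicator (.univ_pi hs)]
  have : ((Set.univ.pi s).indicator fun x : Fin n → α => ∏ i, f (x i)) =
      fun x => ∏ i, (s i).indicator f (x i) := by
    ext x
    by_cases h : x ∈ Set.univ.pi s
    · rw [Set.indicator_of_mem h]
      exact Finset.prod_congr rfl fun i _ => (Set.indicator_of_mem (h i trivial) f).symm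
    · rw [Set.indicator_of_notMem h]
      obtain ⟨i, hi⟩ : ∃ i, x i ∉ s i := by simpa [Set.mem_pi] using h
      exact (Finset.prod_eq_zero (Finset.mem_univ i) (Set.indicator_of_notMem hi f)).symm
  rw [this, lintegral_pi_prod μ _ fun i => hf.indicator (hs i)]
  simp_rw [lintegral_indicator (hs _), withDensity_apply f (hs _)]

/-! ### The correlated Gaussian pair and its density. -/

lemma posSemidef_corrMatrix {ρ : ℝ} (hρ : |ρ| ≤ 1) : (corrMatrix ρ).PosSemidef := by
  have h2 : ρ ^ 2 ≤ 1 := (sq_le_one_iff_abs_le_one ρ).2 hρ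
  refine Matrix.PosSemidef.of_dotProduct_mulVec_nonneg ?_ fun x => ?_
  · ext i j
    fin_cases i <;> fin_cases j <;> simp [corrMatrix]
  · simp [corrMatrix, Matrix.mulVec, dotProduct, Fin.sum_univ_two]
    nlinarith [sq_nonneg (x 0 + ρ * x 1), mul_nonneg (sub_nonneg.2 h2) (sq_nonneg (x 1))]

lemma multivariateGaussian_corrMatrix {ρ : ℝ} (hρ : |ρ| ≤ 1) :
    multivariateGaussian 0 (corrMatrix ρ) =
      ((gaussianReal 0 1).prod (gaussianReal 0 1)).map
        fun p => !₂[p.1, ρ * p.1 + √(1 - ρ ^ 2) * p.2] := by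
  have h2 : ρ ^ 2 ≤ 1 := (sq_le_one_iff_abs_le_one ρ).2 hρ
  have hs : √(1 - ρ ^ 2) ^ 2 = 1 - ρ ^ 2 := Real.sq_sqrt (by linarith)
  have hmeas : Measurable fun p : ℝ × ℝ => !₂[p.1, ρ * p.1 + √(1 - ρ ^ 2) * p.2] := by
    fun_prop
  have := Measure.isProbabilityMeasure_map (μ := (gaussianReal 0 1).prod (gaussianReal 0 1))
    hmeas.aemeasurable
  refine Measure.ext_of_charFun ?_
  ext t
  rw [charFun_multivariateGaussian (posSemidef_corrMatrix hρ), charFun_apply,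
    integral_map hmeas.aemeasurable (by fun_prop)]
  set s := √(1 - ρ ^ 2)
  have : ∀ p : ℝ × ℝ, Complex.exp (inner ℝ !₂[p.1, ρ * p.1 + s * p.2] t * Complex.I) =
      Complex.exp ((t 0 + ρ * t 1 : ℝ) * p.1 * Complex.I) *
        Complex.exp ((s * t 1 : ℝ) * p.2 * Complex.I) := by
    intro p
    rw [← Complex.exp_add]
    congr 1
    simp [PiLp.inner_apply, Fin.sum_univ_two]
    ring
  simp_rw [this]
  rw [integral_prod_mul (fun x : ℝ => Complex.exp ((t 0 + ρ * t 1 : ℝ) * x * Complex.I))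
    (fun x : ℝ => Complex.exp ((s * t 1 : ℝ) * x * Complex.I)), ← charFun_apply_real,
    ← charFun_apply_real, charFun_gaussianReal, charFun_gaussianReal, ← Complex.exp_add]
  congr 1
  have hs' : (s : ℂ) ^ 2 = 1 - ρ ^ 2 := by exact_mod_cast hs
  simp [corrMatrix, Matrix.mulVec, dotProduct, Fin.sum_univ_two]
  linear_combination (t 1 : ℂ) ^ 2 / 2 * hs'

/-- The density of a pair of standard Gaussian variables with correlation `ρ` with respect to
a pair of independent standard Gaussian variables. -/
def corrDensity (ρ x y : ℝ) : ENNReal :=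
  gaussianPDF 0 (1 - ρ ^ 2).toNNReal (y - ρ * x) / gaussianPDF 0 1 y

lemma measurable_corrDensity (ρ : ℝ) : Measurable fun p : ℝ × ℝ => corrDensity ρ p.1 p.2 := by
  unfold corrDensity
  have := measurable_gaussianPDF
  fun_prop

lemma gaussianPDF_mul_corrDensity (ρ x y : ℝ) :
    gaussianPDF 0 1 y * corrDensity ρ x y = gaussianPDF 0 (1 - ρ ^ 2).toNNReal (y - ρ * x) :=
  ENNReal.mul_div_cancel (gaussianPDF_pos 0 one_ne_zero y).ne' gaussianPDF_ne_top

/-- The definition conditions `y` on `x`, but the density of the pair is symmetric. Conditioning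
either way is what makes the second moment computation linear. -/
lemma corrDensity_comm {ρ : ℝ} (hρ : |ρ| < 1) (x y : ℝ) :
    corrDensity ρ x y = corrDensity ρ y x := by
  have h2 : 0 < 1 - ρ ^ 2 := sub_pos.2 ((sq_lt_one_iff_abs_lt_one ρ).2 hρ)
  unfold corrDensity gaussianPDF
  rw [← ENNReal.ofReal_div_of_pos (gaussianPDFReal_pos _ _ _ one_ne_zero),
    ← ENNReal.ofReal_div_of_pos (gaussianPDFReal_pos _ _ _ one_ne_zero)]
  congr 1
  rw [div_eq_div_iff (gaussianPDFReal_pos _ _ _ one_ne_zero).ne'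
    (gaussianPDFReal_pos _ _ _ one_ne_zero).ne']
  simp only [gaussianPDFReal, Real.coe_toNNReal _ h2.le, NNReal.coe_one]
  rw [mul_mul_mul_comm, mul_mul_mul_comm _ _ _ (Real.exp (-(y - 0) ^ 2 / (2 * 1))),
    ← Real.exp_add, ← Real.exp_add]
  congr 2
  field_simp
  ring

lemma gaussianPDF_mul_corrDensity' {ρ : ℝ} (hρ : |ρ| < 1) (x y : ℝ) :
    gaussianPDF 0 1 x * corrDensity ρ x y = gaussianPDF 0 (1 - ρ ^ 2).toNNReal (x - ρ * y) := by
  rw [corrDensity_comm hρ, gaussianPDF_mul_corrDensity]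

lemma map_multivariateGaussian_corrMatrix {ρ : ℝ} (hρ : |ρ| < 1) :
    (multivariateGaussian 0 (corrMatrix ρ)).map (fun w => (w 0, w 1)) =
      ((gaussianReal 0 1).prod (gaussianReal 0 1)).withDensity
        fun p => corrDensity ρ p.1 p.2 := by
  have h2 : 0 < 1 - ρ ^ 2 := sub_pos.2 ((sq_lt_one_iff_abs_lt_one ρ).2 hρ)
  have hv : (1 - ρ ^ 2).toNNReal ≠ 0 := by simpa using h2
  rw [multivariateGaussian_corrMatrix hρ.le, Measure.map_map (by fun_prop) (by fun_prop)]
  refine Measure.ext_of_lintegral _ fun h hh => ?_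
  have hf := measurable_corrDensity ρ
  rw [lintegral_map hh (by fun_prop), lintegral_withDensity_eq_lintegral_mul _ hf hh,
    lintegral_prod _ (by fun_prop), lintegral_prod _ (by fun_prop)]
  refine lintegral_congr fun x => ?_
  -- Given the first coordinate `x`, the second is Gaussian with mean `ρ * x` and variance `1 - ρ ^
  -- 2`.
  have hmap : (gaussianReal 0 1).map (fun z => ρ * x + √(1 - ρ ^ 2) * z) =
      gaussianReal (ρ * x) (1 - ρ ^ 2).toNNReal := by
    have := gaussianReal_map_const_add (μ := √(1 - ρ ^ 2) * 0)
      (v := .mk (√(1 - ρ ^ 2) ^ 2) (sq_nonneg _) * 1) (ρ * x)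
    rw [← gaussianReal_map_const_mul, Measure.map_map (by fun_prop) (by fun_prop)] at this
    rw [show (fun z => ρ * x + √(1 - ρ ^ 2) * z) = (ρ * x + ·) ∘ (√(1 - ρ ^ 2) * ·) from rfl, this]
    congr 1
    · ring
    · ext
      simp [Real.sq_sqrt h2.le, h2.le]
  have h1 := lintegral_map (μ := gaussianReal 0 1) (f := fun y => h (x, y))
    (g := fun z => ρ * x + √(1 - ρ ^ 2) * z) (by fun_prop) (by fun_prop)
  rw [hmap] at h1
  simp only [Function.comp_apply, Matrix.cons_val_zero, Matrix.cons_val_one,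
    Pi.mul_apply]
  rw [← h1, gaussianReal_of_var_ne_zero _ hv, gaussianReal_of_var_ne_zero _ one_ne_zero,
    lintegral_withDensity_eq_lintegral_mul _ (measurable_gaussianPDF _ _) (by fun_prop),
    lintegral_withDensity_eq_lintegral_mul _ (measurable_gaussianPDF _ _) (by fun_prop)]
  refine lintegral_congr fun y => ?_
  simp only [Pi.mul_apply]
  rw [← mul_assoc, gaussianPDF_mul_corrDensity]
  congr 1
  simp [gaussianPDF, gaussianPDFReal]

/-! ### Densities of the planted laws. -/

/-- The law of a sequence of `n` independent standard Gaussian variables. -/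
abbrev stdGaussianPi (n : ℕ) : Measure (Fin n → ℝ) := Measure.pi fun _ => gaussianReal 0 1

/-- The density of the planted law with respect to the null law. -/
def plantedDensity (ρ : ℝ) {n : ℕ} (σ : Equiv.Perm (Fin n)) (z : Obs n) : ENNReal :=
  ∏ i, corrDensity ρ (z.1 i) (z.2 (σ i))

lemma measurable_plantedDensity (ρ : ℝ) {n : ℕ} (σ : Equiv.Perm (Fin n)) :
    Measurable (plantedDensity ρ σ) := by
  have h (i : Fin n) : Measurable fun z : Obs n => corrDensity ρ (z.1 i) (z.2 (σ i)) := by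
    have hz : Measurable fun z : Obs n => (z.1 i, z.2 (σ i)) := by fun_prop
    have := (measurable_corrDensity ρ).comp hz
    simpa only [Function.comp_def] using this
  exact Finset.measurable_fun_prod _ fun i _ => h i

lemma measurePreserving_pairs {n : ℕ} (σ : Equiv.Perm (Fin n)) :
    MeasurePreserving
      (fun v : Fin n → ℝ × ℝ => ((fun i => (v i).1, fun j => (v (σ.symm j)).2) : Obs n))
      (Measure.pi fun _ => (gaussianReal 0 1).prod (gaussianReal 0 1))
      ((stdGaussianPi n).prod (stdGaussianPi n)) := by
  have h1 := measurePreserving_arrowProdEquivProdArrow ℝ ℝ (Fin n)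
    (fun _ => gaussianReal 0 1) (fun _ => gaussianReal 0 1)
  have h2 := (MeasurePreserving.id (stdGaussianPi n)).prod
    (measurePreserving_piCongrLeft (fun _ : Fin n => gaussianReal 0 1) σ)
  convert h2.comp h1 using 1
  ext v j
  · rfl
  · obtain ⟨k, rfl⟩ := σ.surjective j
    simp [MeasurableEquiv.coe_piCongrLeft, MeasurableEquiv.arrowProdEquivProdArrow,
      Equiv.arrowProdEquivProdArrow, Equiv.piCongrLeft_apply_apply]

lemma plantedLaw_eq_withDensity {ρ : ℝ} (hρ : |ρ| < 1) {n : ℕ} (σ : Equiv.Perm (Fin n)) :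
    plantedLaw ρ n σ =
      ((stdGaussianPi n).prod (stdGaussianPi n)).withDensity (plantedDensity ρ σ) := by
  let G : (Fin n → ℝ × ℝ) → Obs n := fun v => (fun i => (v i).1, fun j => (v (σ.symm j)).2)
  have hG : Measurable G := (measurePreserving_pairs σ).measurable
  have hpair : Measurable fun w : EuclideanSpace ℝ (Fin 2) => (w 0, w 1) := by fun_prop
  have hprob : IsProbabilityMeasure
      ((multivariateGaussian 0 (corrMatrix ρ)).map fun w => (w 0, w 1)) :=
    Measure.isProbabilityMeasure_map hpair.aemeasurable
  have hto : toObs σ = G ∘ fun w i => (w i 0, w i 1) := rfl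
  rw [plantedLaw, hto, ← Measure.map_map hG (by fun_prop),
    Measure.pi_map_pi (f := fun _ (w : EuclideanSpace ℝ (Fin 2)) => (w 0, w 1)) fun _ => hpair.aemeasurable]
  rw [map_multivariateGaussian_corrMatrix hρ] at hprob ⊢
  rw [pi_withDensity _ _ (measurable_corrDensity ρ), ← (measurePreserving_pairs σ).map_eq]
  ext s hs
  rw [Measure.map_apply hG hs, withDensity_apply _ (hG hs), withDensity_apply _ hs,
    setLIntegral_map hs (measurable_plantedDensity ρ σ) hG]
  refine lintegral_congr fun v => ?_
  simp [plantedDensity, G]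

lemma nullLaw_eq_prod (n : ℕ) : nullLaw n = (stdGaussianPi n).prod (stdGaussianPi n) := by
  have h := plantedLaw_eq_withDensity (ρ := 0) (by simp) (1 : Equiv.Perm (Fin n))
  have h1 : plantedDensity 0 (1 : Equiv.Perm (Fin n)) = 1 := by
    ext z
    refine Finset.prod_eq_one fun i _ => ?_
    simpa [corrDensity] using
      ENNReal.div_self (gaussianPDF_pos 0 one_ne_zero _).ne' gaussianPDF_ne_top
  rw [h1, withDensity_one] at h
  exact h

/-! ### The Gaussian integral for a pair of permutations. -/

/-- The matrix of the linear map `y ↦ (y (σ i) - q * y (τ i))ᵢ`. -/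
def permDiffMatrix {n : ℕ} (q : ℝ) (σ τ : Equiv.Perm (Fin n)) : Matrix (Fin n) (Fin n) ℝ :=
  Matrix.of fun i j => (if σ i = j then 1 else 0) - q * (if τ i = j then 1 else 0)

lemma abs_det_permDiffMatrix {n : ℕ} (q : ℝ) (σ τ : Equiv.Perm (Fin n)) :
    |(permDiffMatrix q σ τ).det| = |(oneSubPermMatrix (fun _ => q) (σ⁻¹ * τ)).det| := by
  have : permDiffMatrix q σ τ =
      (oneSubPermMatrix (fun _ => q) (σ⁻¹ * τ)).submatrix id ((σ⁻¹ : Equiv.Perm (Fin n))) := by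
    ext i j
    simp [permDiffMatrix, oneSubPermMatrix, Equiv.eq_symm_apply]
  rw [this, Matrix.det_permute', abs_mul]
  rcases Int.units_eq_one_or (Equiv.Perm.sign σ⁻¹) with h | h <;> simp [h]

/-- A kernel vector satisfies `v i = q * v (π i)`, so its `ℓ¹` norm equals `q` times itself and
vanishes. -/
lemma det_oneSubPermMatrix_ne_zero {n : ℕ} {q : ℝ} (hq0 : 0 ≤ q) (hq1 : q < 1)
    (π : Equiv.Perm (Fin n)) : (oneSubPermMatrix (fun _ => q) π).det ≠ 0 := by
  have key : ∀ v : Fin n → ℝ, (oneSubPermMatrix (fun _ => q) π).mulVec v = 0 → v = 0 := by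
    intro v hv
    have h (i : Fin n) : v i = q * v (π i) := by
      have := congrFun hv i
      simp [oneSubPermMatrix, Matrix.mulVec, dotProduct, sub_mul, Finset.sum_sub_distrib] at this
      linarith
    have hsum : ∑ i, |v i| = q * ∑ i, |v i| := by
      conv_lhs => enter [2, i]; rw [h i, abs_mul, abs_of_nonneg hq0]
      rw [← Finset.mul_sum, Equiv.sum_comp π fun i => |v i|]
    have h0 : ∑ i, |v i| = 0 := by
      have : (1 - q) * ∑ i, |v i| = 0 := by linarith
      exact (mul_eq_zero.1 this).resolve_left (by linarith)
    ext i
    simpa using (Finset.sum_eq_zero_iff_of_nonneg fun i _ => abs_nonneg (v i)).1 h0 i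
      (Finset.mem_univ i)
  intro h
  obtain ⟨v, hv, hv'⟩ := Matrix.exists_mulVec_eq_zero_iff.2 h
  exact hv (key v hv')

lemma lintegral_comp_mulVec_sub {n : ℕ} {A : Matrix (Fin n) (Fin n) ℝ} (hA : A.det ≠ 0)
    (c : Fin n → ℝ) {h : (Fin n → ℝ) → ENNReal} (hh : Measurable h) :
    ∫⁻ y, h (A.mulVec y - c) = ENNReal.ofReal |A.det|⁻¹ * ∫⁻ y, h y := by
  have hmeas : Measurable (Matrix.toLin' A) :=
    (LinearMap.continuous_of_finiteDimensional _).measurable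
  have h1 := lintegral_map (μ := volume) (f := fun y => h (y - c)) (g := Matrix.toLin' A)
    (by fun_prop) hmeas
  simp only [Matrix.toLin'_apply] at h1
  rw [← h1, Real.map_matrix_volume_pi_eq_smul_volume_pi hA, lintegral_smul_measure,
    lintegral_sub_right_eq_self h c, abs_inv, smul_eq_mul]

lemma lintegral_prod_gaussianPDF {n : ℕ} {v : NNReal} (hv : v ≠ 0) :
    ∫⁻ x : Fin n → ℝ, ∏ i, gaussianPDF 0 v (x i) = 1 := by
  have := lintegral_pi_prod (volume : Measure ℝ) (fun _ : Fin n => gaussianPDF 0 v)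
    fun _ => measurable_gaussianPDF _ _
  rw [volume_pi, this]
  simp [lintegral_gaussianPDF_eq_one 0 hv]

lemma stdGaussianPi_eq_withDensity (n : ℕ) :
    stdGaussianPi n = volume.withDensity fun x => ∏ i, gaussianPDF 0 1 (x i) := by
  have : IsProbabilityMeasure (volume.withDensity (gaussianPDF 0 1)) := by
    rw [← gaussianReal_of_var_ne_zero 0 one_ne_zero]
    infer_instance
  rw [stdGaussianPi, gaussianReal_of_var_ne_zero 0 one_ne_zero,
    pi_withDensity _ _ (measurable_gaussianPDF _ _), volume_pi]

/-- The weight in `x` is absorbed into the `τ` factor and the weight in `y` into the `σ` factor,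
leaving centred Gaussian densities at `x i - ρ * y (τ i)` and `y (σ i) - ρ * x i`. Linear changes of
variables then integrate these out, at the cost of one Jacobian. -/
lemma lintegral_plantedDensity_mul {ρ : ℝ} (hρ : |ρ| < 1) {n : ℕ} (σ τ : Equiv.Perm (Fin n)) :
    ∫⁻ z, plantedDensity ρ σ z * plantedDensity ρ τ z
        ∂(stdGaussianPi n).prod (stdGaussianPi n) =
      ENNReal.ofReal |(oneSubPermMatrix (fun _ => ρ ^ 2) (σ⁻¹ * τ)).det|⁻¹ := by
  have hq1 : ρ ^ 2 < 1 := (sq_lt_one_iff_abs_lt_one ρ).2 hρ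
  have hv : (1 - ρ ^ 2).toNNReal ≠ 0 := by simpa using hq1
  set g : ℝ → ENNReal := gaussianPDF 0 (1 - ρ ^ 2).toNNReal with hgdef
  have hg : Measurable g := measurable_gaussianPDF _ _
  have hφ : Measurable (gaussianPDF 0 1) := measurable_gaussianPDF _ _
  have hφn : Measurable fun x : Fin n → ℝ => ∏ i, gaussianPDF 0 1 (x i) := by fun_prop
  have hσ := measurable_plantedDensity ρ σ
  have hτ := measurable_plantedDensity ρ τ
  rw [stdGaussianPi_eq_withDensity, prod_withDensity hφn hφn,
    lintegral_withDensity_eq_lintegral_mul _ (by fun_prop) (by fun_prop)]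
  have hpt (z : Obs n) : (∏ i, gaussianPDF 0 1 (z.1 i)) * (∏ i, gaussianPDF 0 1 (z.2 i)) *
      (plantedDensity ρ σ z * plantedDensity ρ τ z) =
      (∏ i, g (z.1 i - ρ * z.2 (τ i))) * ∏ i, g (z.2 (σ i) - ρ * z.1 i) := by
    rw [← Equiv.prod_comp σ fun i => gaussianPDF 0 1 (z.2 i)]
    simp_rw [plantedDensity, ← Finset.prod_mul_distrib]
    refine Finset.prod_congr rfl fun i _ => ?_
    rw [hgdef, ← gaussianPDF_mul_corrDensity ρ (z.1 i) (z.2 (σ i)),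
      ← gaussianPDF_mul_corrDensity' hρ (z.1 i) (z.2 (τ i))]
    ring
  simp only [Pi.mul_apply, hpt]
  rw [lintegral_prod_symm _ (by fun_prop)]
  calc _ = ∫⁻ y : Fin n → ℝ, ∫⁻ x : Fin n → ℝ, (∏ i, g (x i)) *
          ∏ i, g (((permDiffMatrix (ρ ^ 2) σ τ).mulVec y - ρ • x) i) := by
        refine lintegral_congr fun y => ?_
        -- The shift decouples the first factor from `y` and turns the second argument into `y (σ i)
        -- - ρ ^ 2 * y (τ i) - ρ * x i`.
        rw [← lintegral_add_right_eq_self _ fun i => ρ * y (τ i)]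
        refine lintegral_congr fun x => ?_
        congr 1
        · simp
        · refine Finset.prod_congr rfl fun i _ => ?_
          congr 1
          simp [permDiffMatrix, Matrix.mulVec, dotProduct, sub_mul, Finset.sum_sub_distrib]
          ring
    _ = ∫⁻ x : Fin n → ℝ, ∫⁻ y : Fin n → ℝ, (∏ i, g (x i)) *
          ∏ i, g (((permDiffMatrix (ρ ^ 2) σ τ).mulVec y - ρ • x) i) := by
        refine lintegral_lintegral_swap (Measurable.aemeasurable ?_)
        have : Continuous fun y : Fin n → ℝ => (permDiffMatrix (ρ ^ 2) σ τ).mulVec y := by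
          fun_prop
        have := this.measurable
        fun_prop
    _ = ∫⁻ x : Fin n → ℝ, (∏ i, g (x i)) *
          ENNReal.ofReal |(permDiffMatrix (ρ ^ 2) σ τ).det|⁻¹ := by
        refine lintegral_congr fun x => ?_
        have : Continuous fun y : Fin n → ℝ => (permDiffMatrix (ρ ^ 2) σ τ).mulVec y := by
          fun_prop
        have := this.measurable
        rw [lintegral_const_mul _ (by fun_prop), lintegral_comp_mulVec_sub ?_ _
          (h := fun u => ∏ i, g (u i)) (by fun_prop), lintegral_prod_gaussianPDF hv, mul_one]
        rw [← abs_ne_zero, abs_det_permDiffMatrix, abs_ne_zero]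
        exact det_oneSubPermMatrix_ne_zero (sq_nonneg ρ) hq1 _
    _ = _ := by
        rw [lintegral_mul_const _ (by fun_prop), lintegral_prod_gaussianPDF hv, one_mul,
          abs_det_permDiffMatrix]

/-! ### The likelihood ratio and its second moment. -/

/-- The likelihood ratio of the alternative with respect to the null hypothesis. -/
def likelihoodRatio (ρ : ℝ) (n : ℕ) (z : Obs n) : ENNReal :=
  (n.factorial : ENNReal)⁻¹ * ∑ σ : Equiv.Perm (Fin n), plantedDensity ρ σ z

lemma measurable_likelihoodRatio (ρ : ℝ) (n : ℕ) : Measurable (likelihoodRatio ρ n) := by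
  have := measurable_plantedDensity ρ (n := n)
  unfold likelihoodRatio
  fun_prop

lemma altLaw_eq_withDensity {ρ : ℝ} (hρ : |ρ| < 1) (n : ℕ) :
    altLaw ρ n = (nullLaw n).withDensity (likelihoodRatio ρ n) := by
  have hm := measurable_plantedDensity ρ (n := n)
  refine Measure.ext_of_lintegral _ fun h hh => ?_
  rw [lintegral_withDensity_eq_lintegral_mul _ (measurable_likelihoodRatio ρ n) hh, altLaw,
    lintegral_smul_measure, lintegral_finsetSum_measure, nullLaw_eq_prod]
  simp_rw [plantedLaw_eq_withDensity hρ, lintegral_withDensity_eq_lintegral_mul _ (hm _) hh]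
  rw [← lintegral_finsetSum _ (by fun_prop), Fintype.card_perm, Fintype.card_fin, smul_eq_mul,
    ← lintegral_const_mul _ (by fun_prop)]
  refine lintegral_congr fun z => ?_
  simp only [likelihoodRatio, Pi.mul_apply]
  rw [mul_assoc, Finset.sum_mul]

lemma lintegral_likelihoodRatio_sq {ρ : ℝ} (hρ : |ρ| < 1) (n : ℕ) :
    ∫⁻ z, likelihoodRatio ρ n z ^ 2 ∂nullLaw n = ENNReal.ofReal (permAvg (ρ ^ 2) n) := by
  have hm := measurable_plantedDensity ρ (n := n)
  have hfac : (0 : ℝ) < n.factorial := by positivity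
  have hpt (z : Obs n) : likelihoodRatio ρ n z ^ 2 = ((n.factorial : ENNReal)⁻¹) ^ 2 *
      ∑ σ : Equiv.Perm (Fin n), ∑ τ : Equiv.Perm (Fin n),
        plantedDensity ρ σ z * plantedDensity ρ τ z := by
    rw [likelihoodRatio, mul_pow, sq (∑ σ, _), Finset.sum_mul_sum]
  simp_rw [hpt]
  rw [lintegral_const_mul _ (by fun_prop), lintegral_finsetSum _ (by fun_prop), nullLaw_eq_prod]
  have hσ (σ : Equiv.Perm (Fin n)) : ∫⁻ z, ∑ τ : Equiv.Perm (Fin n),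
      plantedDensity ρ σ z * plantedDensity ρ τ z ∂(stdGaussianPi n).prod (stdGaussianPi n) =
      ENNReal.ofReal (permSum fun _ : Fin n => ρ ^ 2) := by
    rw [lintegral_finsetSum _ (by fun_prop)]
    simp_rw [lintegral_plantedDensity_mul hρ]
    rw [← ENNReal.ofReal_sum_of_nonneg fun _ _ => by positivity, permSum]
    congr 1
    exact Equiv.sum_comp (Equiv.mulLeft σ⁻¹)
      fun π => |(oneSubPermMatrix (fun _ => ρ ^ 2) π).det|⁻¹
  simp_rw [hσ]
  rw [Finset.sum_const, Finset.card_univ, Fintype.card_perm, Fintype.card_fin, nsmul_eq_mul,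
    permAvg, div_eq_inv_mul, ENNReal.ofReal_mul (by positivity), ENNReal.ofReal_inv_of_pos hfac,
    ENNReal.ofReal_natCast, sq, mul_assoc, ← mul_assoc _ (n.factorial : ENNReal),
    ENNReal.inv_mul_cancel (by positivity) (ENNReal.natCast_ne_top _), one_mul]

instance isProbabilityMeasure_nullLaw (n : ℕ) : IsProbabilityMeasure (nullLaw n) := by
  rw [nullLaw_eq_prod]
  infer_instance

lemma measurable_toObs {n : ℕ} (σ : Equiv.Perm (Fin n)) : Measurable (toObs σ) := by
  unfold toObs
  fun_prop

instance isProbabilityMeasure_altLaw (ρ : ℝ) (n : ℕ) : IsProbabilityMeasure (altLaw ρ n) := by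
  have (σ : Equiv.Perm (Fin n)) : IsProbabilityMeasure (plantedLaw ρ n σ) :=
    Measure.isProbabilityMeasure_map (measurable_toObs σ).aemeasurable
  refine ⟨?_⟩
  simp only [altLaw, Measure.smul_apply, Measure.coe_finsetSum, Finset.sum_apply, measure_univ,
    Finset.sum_const, Finset.card_univ, nsmul_eq_mul, mul_one, smul_eq_mul]
  exact ENNReal.inv_mul_cancel (by simp [Fintype.card_ne_zero]) (ENNReal.natCast_ne_top _)

/-! ### From the second moment to the risk. -/

/-- The second moment bound for the difference of two probability measures. -/
lemma sq_measureReal_sub_withDensity_le {Ω : Type*} [MeasurableSpace Ω] (μ : Measure Ω)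
    [IsProbabilityMeasure μ] {L : Ω → ENNReal} (hL : Measurable L)
    [IsProbabilityMeasure (μ.withDensity L)] {C : ℝ} (hC : 0 ≤ C)
    (hL2 : ∫⁻ ω, L ω ^ 2 ∂μ ≤ ENNReal.ofReal C) {A : Set Ω} (hA : MeasurableSet A) :
    (μ.real A - (μ.withDensity L).real A) ^ 2 ≤ C - 1 := by
  have hL1 : ∫⁻ ω, L ω ∂μ = 1 := by
    rw [← setLIntegral_univ, ← withDensity_apply _ .univ, measure_univ]
  have hfin : ∀ᵐ ω ∂μ, L ω < ⊤ := ae_lt_top hL (by simp [hL1])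
  set l : Ω → ℝ := fun ω => (L ω).toReal
  have hl : Measurable l := hL.ennreal_toReal
  have hl2 : ∫ ω, l ω ^ 2 ∂μ ≤ C := by
    rw [integral_eq_lintegral_of_nonneg_ae (.of_forall fun ω => sq_nonneg _)
      (hl.pow_const 2).aestronglyMeasurable]
    refine ENNReal.toReal_le_of_le_ofReal hC (le_trans (lintegral_mono_ae ?_) hL2)
    filter_upwards [hfin] with ω hω
    simp [l, ENNReal.ofReal_pow, ENNReal.ofReal_toReal hω.ne]
  have hmem : MemLp l 2 μ := by
    rw [memLp_two_iff_integrable_sq hl.aestronglyMeasurable]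
    refine ⟨(hl.pow_const 2).aestronglyMeasurable, ?_⟩
    rw [hasFiniteIntegral_iff_ofReal (.of_forall fun ω => sq_nonneg _)]
    refine lt_of_le_of_lt (le_trans (lintegral_mono_ae ?_) hL2) ENNReal.ofReal_lt_top
    filter_upwards [hfin] with ω hω
    simp [l, ENNReal.ofReal_pow, ENNReal.ofReal_toReal hω.ne]
  have hint : Integrable l μ := hmem.integrable one_le_two
  have hl1 : ∫ ω, l ω ∂μ = 1 := by
    rw [integral_toReal hL.aemeasurable hfin, hL1, ENNReal.toReal_one]
  have hd : MemLp (fun ω => 1 - l ω) 2 μ := (memLp_const 1).sub hmem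
  set D : Ω → ℝ := A.indicator fun ω => 1 - l ω with hD
  have hDmem : MemLp D 2 μ := hd.indicator hA
  have hDint : ∫ ω, D ω ∂μ = μ.real A - (μ.withDensity L).real A := by
    rw [hD, integral_indicator hA, integral_sub (integrable_const _).integrableOn
      hint.integrableOn, integral_toReal hL.aemeasurable.restrict (ae_restrict_of_ae hfin),
      ← withDensity_apply _ hA]
    simp [Measure.real]
  have hDsq : ∫ ω, (D ^ 2) ω ∂μ ≤ C - 1 := by
    calc _ ≤ ∫ ω, (1 - l ω) ^ 2 ∂μ := by
          refine integral_mono hDmem.integrable_sq hd.integrable_sq fun ω => ?_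
          by_cases h : ω ∈ A
          · simp [hD, h]
          · simp [hD, h, sq_nonneg]
      _ = ∫ ω, (1 - 2 * l ω + l ω ^ 2) ∂μ := by
          refine integral_congr_ae (.of_forall fun ω => ?_)
          ring
      _ = 1 - 2 + ∫ ω, l ω ^ 2 ∂μ := by
          have h1 : Integrable (fun ω => 1 - 2 * l ω) μ :=
            (integrable_const _).sub (hint.const_mul 2)
          rw [integral_add h1 hmem.integrable_sq,
            integral_sub (integrable_const _) (hint.const_mul 2), integral_const_mul, hl1]
          simp
      _ ≤ C - 1 := by linarith
  -- Nonnegative variance gives `(∫ D)² ≤ ∫ D²`, the Cauchy–Schwarz step.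
  have hvar := variance_nonneg D μ
  rw [variance_eq_sub hDmem, hDint] at hvar
  linarith

lemma one_sub_sqrt_le_risk {ρ : ℝ} (hρ : ρ ^ 2 < 1 / 2) {n : ℕ} {φ : Obs n → Fin 2}
    (hφ : Measurable φ) :
    1 - √((1 - ρ ^ 2 / (1 - ρ ^ 2))⁻¹ - 1) ≤ risk ρ n φ := by
  have hρ1 : |ρ| < 1 := (sq_lt_one_iff_abs_lt_one ρ).1 (by linarith)
  set C := (1 - ρ ^ 2 / (1 - ρ ^ 2))⁻¹ with hCdef
  have hC : 0 ≤ C := by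
    have h : ρ ^ 2 / (1 - ρ ^ 2) < 1 := by rw [div_lt_one (by linarith)]; linarith
    exact inv_nonneg.2 (by linarith)
  have halt := altLaw_eq_withDensity hρ1 n
  have hprob : IsProbabilityMeasure ((nullLaw n).withDensity (likelihoodRatio ρ n)) :=
    halt ▸ isProbabilityMeasure_altLaw ρ n
  have hA : MeasurableSet {z | φ z = 0} := hφ (measurableSet_singleton 0)
  have key := sq_measureReal_sub_withDensity_le (nullLaw n) (measurable_likelihoodRatio ρ n) hC
    (by rw [lintegral_likelihoodRatio_sq hρ1]
        exact ENNReal.ofReal_le_ofReal (permAvg_le (sq_nonneg ρ) hρ n)) hA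
  rw [← halt] at key
  have hcompl : {z | φ z = 1} = {z | φ z = 0}ᶜ := by
    ext z
    simp only [Set.mem_ofPred_eq, Set.mem_compl_iff]
    generalize φ z = a
    fin_cases a <;> simp
  rw [risk, hcompl, measureReal_compl hA, probReal_univ]
  have := Real.le_sqrt_of_sq_le key
  linarith

lemma one_sub_sqrt_le_optRisk {ρ : ℝ} (hρ : ρ ^ 2 < 1 / 2) (n : ℕ) :
    1 - √((1 - ρ ^ 2 / (1 - ρ ^ 2))⁻¹ - 1) ≤ optRisk ρ n := by
  have : Nonempty {φ : Obs n → Fin 2 // Measurable φ} := ⟨⟨fun _ => 0, measurable_const⟩⟩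
  exact le_ciInf fun φ => one_sub_sqrt_le_risk hρ φ.2

lemma optRisk_le_one (ρ : ℝ) (n : ℕ) : optRisk ρ n ≤ 1 := by
  have hbdd : BddBelow (Set.range fun φ : {φ : Obs n → Fin 2 // Measurable φ} => risk ρ n φ) :=
    ⟨0, by rintro _ ⟨φ, rfl⟩; exact add_nonneg measureReal_nonneg measureReal_nonneg⟩
  -- Always accepting the null has risk exactly 1.
  refine (ciInf_le hbdd ⟨fun _ => 0, measurable_const⟩).trans ?_
  simp [risk]

lemma tendsto_optRisk {ρ : ℕ → ℝ} (n : ℕ → ℕ)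
    (hlim : Tendsto (fun k => ρ k ^ 2) atTop (𝓝 0)) :
    Tendsto (fun k => optRisk (ρ k) (n k)) atTop (𝓝 1) := by
  have hcont : ContinuousAt (fun q : ℝ => 1 - √((1 - q / (1 - q))⁻¹ - 1)) 0 := by
    have : ContinuousAt (fun q : ℝ => (1 - q / (1 - q))⁻¹) 0 :=
      ContinuousAt.inv₀ (by fun_prop (disch := simp)) (by simp)
    fun_prop
  have hlow := hcont.tendsto.comp hlim
  simp only [zero_div, sub_zero, inv_one, sub_self, Real.sqrt_zero] at hlow
  refine tendsto_of_tendsto_of_tendsto_of_le_of_le' hlow tendsto_const_nhds ?_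
    (.of_forall fun k => optRisk_le_one _ _)
  filter_upwards [hlim.eventually_lt_const (by norm_num : (0 : ℝ) < 1 / 2)] with k hk
  exact one_sub_sqrt_le_optRisk hk _

end

end DatabaseDetection

theorem theorem2 (ρ : ℕ → ℝ) (n : ℕ → ℕ) (hρ : ∀ k, |ρ k| ≤ 1)
    (hlim : Tendsto (fun k => ρ k ^ 2) atTop (𝓝 0)) :
    Tendsto (fun k => DatabaseDetection.optRisk (ρ k) (n k)) atTop (𝓝 1) ∧
      ¬ DatabaseDetection.AdmissibleWeak ρ n := by
  have h := DatabaseDetection.tendsto_optRisk n hlim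
  refine ⟨h, ?_⟩
  rw [DatabaseDetection.AdmissibleWeak, h.limsup_eq]
  exact lt_irrefl 1
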